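/- Let $n\ge 2$, $\bar v>0$ and $m\in(0,\bar v)^n$. Let $\Delta(m,\bar v)$ be the set of Borel probability distributions $F$ on $[0,\bar v]^n$ with $\int v_i\,dF(v)=m_i$ for all $i$. Let $\mathcal M$ be the set of direct deterministic mechanisms $M=(x_i,t_i)_{i=1}^n$, with $x_i:[0,\bar v]^n\to\{0,1\}$ and $t_i:[0,\bar v]^n\to\mathbb R$ measurable and $\sum_i x_i\le 1$, that are dominant-strategy incentive compatible and ex post individually rational for bidders with payoffs $v_ix_i-t_i$. Put $R(M,F)=\int\sum_i t_i\,dF\in[-\infty,\infty)$ (the total transfer is bounded above for $M\in\mathcal M$) and $\underline R(M)=\inf_{F\in\Delta(m,\bar v)}R(M,F)$. For $r\in[0,\bar v]^n$ define the scores $s_i(v_i)=\beta_iv_i-\alpha_i$, where $\beta_i=\frac1{\bar v-r_i}$ and $\alpha_i=\frac{r_i}{\bar v-r_i}$ if $r_i<\bar v$, and $\beta_i=1$ and $\alpha_i=r_i$ if $r_i=\bar v$. A *corner-hitting linear score auction* is a mechanism $M\in\mathcal M$ such that, for some $r\in[0,\bar v]^n$ and for all $i$ and $v$, $x_i(v)=1$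 if $s_i(v_i)>\max\{\max_{j\ne i}s_j(v_j),0\}$ and $x_i(v)=0$ if $s_i(v_i)<\max\{\max_{j\ne i}s_j(v_j),0\}$. Then there exists a corner-hitting linear score auction $M^*\in\mathcal M$ that solves the maxmin problem $\sup_{M\in\mathcal M}\inf_{F\in\Delta(m,\bar v)}R(M,F)$, that is, $$\underline R(M^*)=\sup_{M\in\mathcal M}\underline R(M).$$ -/

import Mathlib

open MeasureTheory

noncomputable section

namespace RobustAuction

/-- Value profiles: points of the cube `[0, vbar]^n`, with its Borel (product) sigma-algebra. -/
abbrev Profile (n : ℕ) (vbar : ℝ) : Type := Fin n → Set.Icc (0 : ℝ) vbar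

/-- A direct deterministic mechanism: measurable allocation functions with values in `{0, 1}`
that award the object at most once, and measurable real-valued transfers. -/
structure Mechanism (n : ℕ) (vbar : ℝ) where
  x : Fin n → Profile n vbar → ℝ
  t : Fin n → Profile n vbar → ℝ
  measurable_x : ∀ i, Measurable (x i)
  measurable_t : ∀ i, Measurable (t i)
  deterministic : ∀ i v, x i v = 0 ∨ x i v = 1
  supply : ∀ v, ∑ i, x i v ≤ 1

variable {n : ℕ} {vbar : ℝ}

/-- The ex post payoff of bidder `i` with value `w` when the reported profile is `v`. -/
def Mechanism.payoff (M : Mechanism n vbar) (i : Fin n) (w : Set.Icc (0 : ℝ) vbar)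
    (v : Profile n vbar) : ℝ :=
  (w : ℝ) * M.x i v - M.t i v

/-- Dominant-strategy incentive compatibility: whatever the others report, no bidder gains by
reporting `w` instead of her value `v i`. -/
def Mechanism.IsDSIC (M : Mechanism n vbar) : Prop :=
  ∀ (i : Fin n) (v : Profile n vbar) (w : Set.Icc (0 : ℝ) vbar),
    M.payoff i (v i) (Function.update v i w) ≤ M.payoff i (v i) v

/-- Ex post individual rationality. -/
def Mechanism.IsEPIR (M : Mechanism n vbar) : Prop :=
  ∀ (i : Fin n) (v : Profile n vbar), 0 ≤ M.payoff i (v i) v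

/-- The admissible mechanisms: dominant-strategy incentive compatible, ex post individually
rational, deterministic, direct. -/
def admissible (n : ℕ) (vbar : ℝ) : Set (Mechanism n vbar) :=
  {M | M.IsDSIC ∧ M.IsEPIR}

/-- Borel probability distributions on the cube with mean vector `m`. -/
def distributions (vbar : ℝ) (m : Fin n → ℝ) : Set (Measure (Profile n vbar)) :=
  {F | IsProbabilityMeasure F ∧ ∀ i, ∫ v, (v i : ℝ) ∂F = m i}

/-- Total transfer collected at the profile `v`. -/
def Mechanism.totalTransfer (M : Mechanism n vbar) (v : Profile n vbar) : ℝ :=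
  ∑ i, M.t i v

/-- Expected revenue, the integral of the positive part minus the integral of the negative part.
In an admissible mechanism the total transfer is at most `n * vbar`, so the first term is finite
and the value, possibly `-∞`, is the genuine (extended) integral; no integrability is needed. -/
def Mechanism.revenue (M : Mechanism n vbar) (F : Measure (Profile n vbar)) : EReal :=
  ((∫⁻ v, ENNReal.ofReal (M.totalTransfer v) ∂F : ENNReal) : EReal) -
    ((∫⁻ v, ENNReal.ofReal (-M.totalTransfer v) ∂F : ENNReal) : EReal)

/-- The revenue guarantee: the infimum of expected revenue over all distributions with mean `m`. -/
def Mechanism.guarantee (M : Mechanism n vbar) (m : Fin n → ℝ) : EReal :=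
  ⨅ F ∈ distributions vbar m, M.revenue F

/-- `M` solves the maxmin problem: it is admissible and attains the supremum of the revenue
guarantee over all admissible mechanisms. -/
def Mechanism.SolvesMaxmin (M : Mechanism n vbar) (m : Fin n → ℝ) : Prop :=
  M ∈ admissible n vbar ∧ M.guarantee m = ⨆ M' ∈ admissible n vbar, M'.guarantee m

/-- The linear score `β i * v i - α i` of bidder `i`. -/
def score (α β : Fin n → ℝ) (v : Profile n vbar) (i : Fin n) : ℝ :=
  β i * (v i : ℝ) - α i

/-- `max {max_{j ≠ i} s_j(v_j), 0}`. -/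
def rivalScore (α β : Fin n → ℝ) (v : Profile n vbar) (i : Fin n) : ℝ :=
  (Finset.univ.erase i).fold max 0 (score α β v)

/-- `M` is a linear score auction with parameters `α`, `β`; ties are broken arbitrarily. -/
def Mechanism.IsLinearScoreAuction (M : Mechanism n vbar) (α β : Fin n → ℝ) : Prop :=
  M ∈ admissible n vbar ∧ (∀ i, 0 ≤ α i ∧ 0 < β i) ∧
    ∀ i v, (rivalScore α β v i < score α β v i → M.x i v = 1) ∧
      (score α β v i < rivalScore α β v i → M.x i v = 0)

/-- The slope of the corner-hitting score with generalized reserve price `ρ`. -/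
def cornerSlope (vbar ρ : ℝ) : ℝ := if ρ < vbar then 1 / (vbar - ρ) else 1

/-- The intercept of the corner-hitting score with generalized reserve price `ρ`. -/
def cornerIntercept (vbar ρ : ℝ) : ℝ := if ρ < vbar then ρ / (vbar - ρ) else ρ

/-- `M` is a corner-hitting linear score auction, for some vector `r ∈ [0, vbar]^n` of generalized
reserve prices. -/
def Mechanism.IsCornerHitting (M : Mechanism n vbar) : Prop :=
  ∃ r : Fin n → ℝ, (∀ i, r i ∈ Set.Icc (0 : ℝ) vbar) ∧
    M.IsLinearScoreAuction (fun i => cornerIntercept vbar (r i))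
      (fun i => cornerSlope vbar (r i))

end RobustAuction

end

namespace RobustAuction

variable {n : ℕ} {vbar : ℝ}

/-! ### Expected revenue as a Bochner integral -/

/-! The proof is linear programming duality over affine minorants of revenue. Under every
distribution with mean `m`, an affine function integrates to its value at `m`, so any affine
minorant of revenue bounds the guarantee from below (`le_guarantee_of_minorant`). Conversely, `m` is
interior to the cube, so separation produces a minorant with value `a` at `m` whenever no
distribution with integrable revenue brings expected revenue down to `a`
(`exists_minorant_of_notMem`).

Incentive constraints limit the minorants of any admissible mechanism at two profiles, the reserve
profile determined by the slopes and a corner; hence the value at `m` is at most `dualValue` of the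
positive parts of the slopes (`le_dualValue_of_minorant`). For nonnegative slopes the corner-hitting
auction with those reserves attains this bound (`minorant_scoreAuction`). Slopes maximizing
`dualValue` therefore give an optimal auction. -/

lemma Mechanism.measurable_totalTransfer (M : Mechanism n vbar) : Measurable M.totalTransfer :=
  Finset.measurable_sum _ fun i _ => M.measurable_t i

lemma Mechanism.revenue_eq_integral (M : Mechanism n vbar) {F : Measure (Profile n vbar)}
    (hF : Integrable M.totalTransfer F) :
    M.revenue F = ((∫ v, M.totalTransfer v ∂F : ℝ) : EReal) := by
  have h1 : ∫⁻ v, ENNReal.ofReal (M.totalTransfer v) ∂F ≠ ⊤ := hF.lintegral_lt_top.ne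
  have h2 : ∫⁻ v, ENNReal.ofReal (-M.totalTransfer v) ∂F ≠ ⊤ := hF.neg.lintegral_lt_top.ne
  rw [integral_eq_lintegral_pos_part_sub_lintegral_neg_part hF, EReal.coe_sub,
    EReal.coe_ennreal_toReal h1, EReal.coe_ennreal_toReal h2]
  rfl

lemma integrable_coord (F : Measure (Profile n vbar)) [IsFiniteMeasure F] (i : Fin n) :
    Integrable (fun v : Profile n vbar => (v i : ℝ)) F := by
  refine Integrable.of_bound
    (measurable_subtype_coe.comp (measurable_pi_apply i)).aestronglyMeasurable vbar (Filter.Eventually.of_forall fun v => ?_)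
  rw [Real.norm_eq_abs, abs_of_nonneg (v i).2.1]
  exact (v i).2.2

lemma integral_affine {m : Fin n → ℝ} {F : Measure (Profile n vbar)}
    (hF : F ∈ distributions vbar m) (a : ℝ) (l : Fin n → ℝ) :
    Integrable (fun v : Profile n vbar => a + ∑ i, l i * ((v i : ℝ) - m i)) F ∧
      ∫ v, (a + ∑ i, l i * ((v i : ℝ) - m i)) ∂F = a := by
  obtain ⟨hp, hmean⟩ := hF
  have hi : ∀ i ∈ Finset.univ,
      Integrable (fun v : Profile n vbar => l i * ((v i : ℝ) - m i)) F := fun i _ =>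
    ((integrable_coord F i).sub (integrable_const _)).const_mul _
  refine ⟨(integrable_const a).add (integrable_finsetSum _ hi), ?_⟩
  rw [integral_add (integrable_const a) (integrable_finsetSum _ hi), integral_finsetSum _ hi]
  have : ∀ i, ∫ v, l i * ((v i : ℝ) - m i) ∂F = 0 := fun i => by
    rw [integral_const_mul, integral_sub (integrable_coord F i) (integrable_const _), hmean i]
    simp
  simp [this]

/-! ### Pointwise bounds in an admissible mechanism -/

lemma Mechanism.x_nonneg (M : Mechanism n vbar) (i : Fin n) (v : Profile n vbar) :
    0 ≤ M.x i v := by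
  rcases M.deterministic i v with h | h <;> simp [h]

lemma Mechanism.x_eq_zero_of_winner (M : Mechanism n vbar) {i j : Fin n} {v : Profile n vbar}
    (hi : M.x i v = 1) (hij : j ≠ i) : M.x j v = 0 := by
  have h := M.supply v
  rw [← Finset.add_sum_erase _ _ (Finset.mem_univ i), hi] at h
  have hj := Finset.single_le_sum (fun k _ => M.x_nonneg k v)
    (Finset.mem_erase.2 ⟨hij, Finset.mem_univ j⟩)
  exact le_antisymm (by linarith) (M.x_nonneg j v)

lemma Mechanism.t_nonpos_of_loser {M : Mechanism n vbar} (hM : M ∈ admissible n vbar)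
    {i : Fin n} {v : Profile n vbar} (hi : M.x i v = 0) : M.t i v ≤ 0 := by
  have := hM.2 i v
  simp only [Mechanism.payoff, hi] at this
  linarith

lemma Mechanism.totalTransfer_le_of_winner {M : Mechanism n vbar} (hM : M ∈ admissible n vbar)
    {i : Fin n} {v : Profile n vbar} (hi : M.x i v = 1) : M.totalTransfer v ≤ M.t i v := by
  have h : ∑ j ∈ Finset.univ.erase i, M.t j v ≤ 0 := Finset.sum_nonpos fun j hj =>
    M.t_nonpos_of_loser hM (M.x_eq_zero_of_winner hi (Finset.ne_of_mem_erase hj))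
  rw [Mechanism.totalTransfer, ← Finset.add_sum_erase _ _ (Finset.mem_univ i)]
  linarith

/-- If the object is sold to a bidder at `v`, raising that bidder's value to the top leaves the
revenue at most her original value. -/
lemma Mechanism.totalTransfer_dichotomy {M : Mechanism n vbar} (hM : M ∈ admissible n vbar)
    (htop : vbar ∈ Set.Icc 0 vbar) (v : Profile n vbar) :
    M.totalTransfer v ≤ 0 ∨ ∃ i, M.totalTransfer v ≤ v i ∧
      M.totalTransfer (Function.update v i ⟨vbar, htop⟩) ≤ v i := by
  by_cases h : ∃ i, M.x i v = 1
  · obtain ⟨i, hi⟩ := h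
    have hir : M.t i v ≤ v i := by
      have := hM.2 i v
      simp only [Mechanism.payoff, hi] at this
      linarith
    refine Or.inr ⟨i, (M.totalTransfer_le_of_winner hM hi).trans hir, ?_⟩
    rcases eq_or_lt_of_le (v i).2.2 with htv | htv
    · have : Function.update v i ⟨vbar, htop⟩ = v := by
        rw [Function.update_eq_self_iff]; exact Subtype.ext htv.symm
      rw [this]
      exact (M.totalTransfer_le_of_winner hM hi).trans hir
    · have h1 := hM.1 i v ⟨vbar, htop⟩
      have h2 := hM.1 i (Function.update v i ⟨vbar, htop⟩) (v i)
      simp only [Mechanism.payoff, Function.update_idem, Function.update_eq_self,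
        Function.update_self, hi] at h1 h2
      -- Losing at the top would, by adding the two incentive constraints, force `vbar ≤ v i`.
      have hw : M.x i (Function.update v i ⟨vbar, htop⟩) = 1 := by
        rcases M.deterministic i (Function.update v i ⟨vbar, htop⟩) with h0 | h0
        · rw [h0] at h1 h2; linarith
        · exact h0
      rw [hw] at h2
      refine (M.totalTransfer_le_of_winner hM hw).trans ?_
      linarith
  · push Not at h
    exact Or.inl (Finset.sum_nonpos fun i _ =>
      M.t_nonpos_of_loser hM ((M.deterministic i v).resolve_right (h i)))

lemma Mechanism.totalTransfer_le {M : Mechanism n vbar} (hM : M ∈ admissible n vbar)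
    (hvbar : 0 ≤ vbar) (v : Profile n vbar) : M.totalTransfer v ≤ vbar := by
  rcases M.totalTransfer_dichotomy hM ⟨hvbar, le_rfl⟩ v with h | ⟨i, h, -⟩
  · exact h.trans hvbar
  · exact h.trans (v i).2.2

/-! ### The reduced problem -/

/-- The reserve price attached to a bidder whose shadow price is `l`. -/
noncomputable def reserve (vbar l : ℝ) : ℝ := l * vbar / (1 + l)

lemma reserve_nonneg (hvbar : 0 < vbar) {l : ℝ} (hl : 0 ≤ l) : 0 ≤ reserve vbar l := by
  unfold reserve; positivity

lemma reserve_lt (hvbar : 0 < vbar) {l : ℝ} (hl : 0 ≤ l) : reserve vbar l < vbar := by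
  unfold reserve
  rw [div_lt_iff₀ (by linarith)]
  linarith

/-- This equation dictates the choice of reserve: between the reserve and the top, a function of
slope `l` gains exactly the reserve. -/
lemma mul_sub_reserve {l : ℝ} (hl : 0 ≤ l) : l * (vbar - reserve vbar l) = reserve vbar l := by
  unfold reserve
  have : 1 + l ≠ 0 := by linarith
  field_simp
  ring

/-- The largest value at `m` of an affine function with slopes `l` that is nonpositive at the
reserve prices and at most `vbar` at the top corner. -/
noncomputable def dualValue (vbar : ℝ) (m l : Fin n → ℝ) : ℝ :=
  min (∑ i, l i * (m i - reserve vbar (l i))) (vbar - ∑ i, l i * (vbar - m i))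

/-- Compactness on the box `[0, b]` suffices: a coordinate above `b i` makes the second term of the
minimum negative, while zero slopes give 0. -/
lemma exists_dualValue_max (hvbar : 0 < vbar) {m : Fin n → ℝ}
    (hm : ∀ i, m i ∈ Set.Ioo (0 : ℝ) vbar) :
    ∃ l : Fin n → ℝ, (∀ i, 0 ≤ l i) ∧
      ∀ k : Fin n → ℝ, (∀ i, 0 ≤ k i) → dualValue vbar m k ≤ dualValue vbar m l := by
  set b : Fin n → ℝ := fun i => vbar / (vbar - m i) with hb
  have hpos : ∀ i, 0 < vbar - m i := fun i => sub_pos.2 (hm i).2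
  have hb0 : 0 ≤ b := fun i => div_nonneg hvbar.le (hpos i).le
  have hcont : ContinuousOn (dualValue vbar m) (Set.Icc 0 b) := by
    unfold dualValue reserve
    refine ContinuousOn.inf (continuousOn_finsetSum _ fun i _ => ?_) (by fun_prop)
    refine ContinuousOn.mul (by fun_prop) (continuousOn_const.sub ?_)
    refine ContinuousOn.div (by fun_prop) (by fun_prop) fun l hl => ?_
    have : 0 ≤ l i := hl.1 i
    linarith
  obtain ⟨l, hl, hmax⟩ := isCompact_Icc.exists_isMaxOn ⟨0, le_rfl, hb0⟩ hcont
  refine ⟨l, fun i => hl.1 i, fun k hk => ?_⟩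
  by_cases hkb : k ≤ b
  · exact hmax ⟨fun i => hk i, hkb⟩
  · obtain ⟨i, hi⟩ : ∃ i, b i < k i := by
      simpa [Pi.le_def] using hkb
    have h0 : dualValue vbar m 0 ≤ dualValue vbar m l := hmax ⟨le_rfl, hb0⟩
    have h1 : dualValue vbar m 0 = 0 := by simp [dualValue, hvbar.le]
    have h2 : vbar < k i * (vbar - m i) := by
      rwa [hb, div_lt_iff₀ (hpos i)] at hi
    have h3 : k i * (vbar - m i) ≤ ∑ j, k j * (vbar - m j) :=
      Finset.single_le_sum (f := fun j => k j * (vbar - m j))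
        (fun j _ => mul_nonneg (hk j) (hpos j).le) (Finset.mem_univ i)
    have h4 : dualValue vbar m k ≤ vbar - ∑ j, k j * (vbar - m j) := min_le_right _ _
    linarith

/-- An affine function below the revenue of an admissible mechanism has, at the mean, a value at
most the dual value of the positive parts of its slopes. -/
lemma le_dualValue_of_minorant (hvbar : 0 < vbar) {m : Fin n → ℝ}
    (hm : ∀ i, m i ∈ Set.Ioo (0 : ℝ) vbar) {M : Mechanism n vbar} (hM : M ∈ admissible n vbar)
    {a : ℝ} {l : Fin n → ℝ}
    (h : ∀ v : Profile n vbar, a + ∑ i, l i * ((v i : ℝ) - m i) ≤ M.totalTransfer v) :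
    a ≤ dualValue vbar m (fun i => max (l i) 0) := by
  have htop : vbar ∈ Set.Icc 0 vbar := ⟨hvbar.le, le_rfl⟩
  have hl : ∀ i, 0 ≤ max (l i) 0 := fun i => le_max_right _ _
  refine le_min ?_ ?_
  · set r : Profile n vbar := fun i => ⟨reserve vbar (max (l i) 0),
      reserve_nonneg hvbar (hl i), (reserve_lt hvbar (hl i)).le⟩ with hr
    have hLr : a + ∑ i, l i * ((r i : ℝ) - m i) ≤ 0 := by
      rcases M.totalTransfer_dichotomy hM htop r with h0 | ⟨i, hi, hi'⟩
      · exact (h r).trans h0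
      · rcases le_or_gt (l i) 0 with hli | hli
        · have : (r i : ℝ) = 0 := by simp [hr, hli, reserve]
          linarith [h r]
        -- Raising the winner to the top adds exactly `r i` to the affine function, yet revenue
        -- there is at most `r i`.
        · have hu := (h (Function.update r i ⟨vbar, htop⟩)).trans hi'
          have e : ∑ j, l j * (((Function.update r i ⟨vbar, htop⟩ : Profile n vbar) j : ℝ) - m j)
              = ∑ j, l j * ((r j : ℝ) - m j) + l i * (vbar - r i) := by
            rw [← Finset.add_sum_erase _ _ (Finset.mem_univ i),
              ← Finset.add_sum_erase Finset.univ (fun j => l j * ((r j : ℝ) - m j))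
                (Finset.mem_univ i),
              Finset.sum_congr rfl fun j hj => by
                rw [Function.update_of_ne (Finset.ne_of_mem_erase hj)]]
            rw [Function.update_self]
            ring
          have e2 : l i * (vbar - r i) = r i := by
            have := mul_sub_reserve (vbar := vbar) hli.le
            simpa [hr, max_eq_left hli.le] using this
          rw [e, e2] at hu
          linarith
    have : ∑ i, max (l i) 0 * (m i - reserve vbar (max (l i) 0)) =
        ∑ i, max (l i) 0 * (m i - (r i : ℝ)) := rfl
    rw [this]
    -- A negative slope has reserve 0, so its term is negative and may be replaced by 0.
    have h2 : ∑ i, l i * (m i - (r i : ℝ)) ≤ ∑ i, max (l i) 0 * (m i - (r i : ℝ)) := by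
      refine Finset.sum_le_sum fun i _ => ?_
      rcases le_or_gt (l i) 0 with hli | hli
      · have : (r i : ℝ) = 0 := by simp [hr, hli, reserve]
        rw [this, max_eq_right hli]
        have := (hm i).1
        nlinarith
      · rw [max_eq_left hli.le]
    have h3 : ∑ i, l i * (m i - (r i : ℝ)) = -∑ i, l i * ((r i : ℝ) - m i) := by
      rw [← Finset.sum_neg_distrib]
      exact Finset.sum_congr rfl fun i _ => by ring
    linarith
  -- `u` is the corner where the affine function is largest.
  · set u : Profile n vbar := fun i => if 0 ≤ l i then ⟨vbar, htop⟩ else ⟨0, le_rfl, hvbar.le⟩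
      with hu
    have h1 := (h u).trans (M.totalTransfer_le hM hvbar.le u)
    have h2 : ∑ i, max (l i) 0 * (vbar - m i) ≤ ∑ i, l i * ((u i : ℝ) - m i) := by
      refine Finset.sum_le_sum fun i _ => ?_
      by_cases hli : 0 ≤ l i
      · simp [hu, hli]
      · have := (hm i).1
        simp only [hu, hli, if_false, max_eq_right (not_le.1 hli).le]
        nlinarith
    linarith

/-! ### The upper bound: separation -/

/-- Pairs of a mean vector and a number above the expected revenue of a distribution with that
mean. -/
def revenueEpigraph (M : Mechanism n vbar) : Set ((Fin n → ℝ) × ℝ) :=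
  {p | ∃ F ∈ distributions vbar p.1, Integrable M.totalTransfer F ∧
    ∫ v, M.totalTransfer v ∂F ≤ p.2}

lemma convex_revenueEpigraph (M : Mechanism n vbar) : Convex ℝ (revenueEpigraph M) := by
  rintro p ⟨F, ⟨hF, hFm⟩, hFi, hFp⟩ q ⟨G, ⟨hG, hGm⟩, hGi, hGq⟩ a b ha hb hab
  have key : ∀ f : Profile n vbar → ℝ, Integrable f F → Integrable f G →
      Integrable f (ENNReal.ofReal a • F + ENNReal.ofReal b • G) ∧
      ∫ v, f v ∂(ENNReal.ofReal a • F + ENNReal.ofReal b • G) =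
        a * ∫ v, f v ∂F + b * ∫ v, f v ∂G := fun f hf hg => by
    have h1 := hf.smul_measure (c := ENNReal.ofReal a) ENNReal.ofReal_ne_top
    have h2 := hg.smul_measure (c := ENNReal.ofReal b) ENNReal.ofReal_ne_top
    refine ⟨h1.add_measure h2, ?_⟩
    rw [integral_add_measure h1 h2, integral_smul_measure, integral_smul_measure,
      ENNReal.toReal_ofReal ha, ENNReal.toReal_ofReal hb, smul_eq_mul, smul_eq_mul]
  refine ⟨ENNReal.ofReal a • F + ENNReal.ofReal b • G, ⟨⟨?_⟩, fun i => ?_⟩,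
    (key _ hFi hGi).1, ?_⟩
  · simp [← ENNReal.ofReal_add ha hb, hab]
  · rw [(key _ (integrable_coord F i) (integrable_coord G i)).2, hFm, hGm]
    simp
  · rw [(key _ hFi hGi).2]
    exact add_le_add (mul_le_mul_of_nonneg_left hFp ha) (mul_le_mul_of_nonneg_left hGq hb)

lemma mem_revenueEpigraph (M : Mechanism n vbar) (v : Profile n vbar) {y : ℝ}
    (hy : M.totalTransfer v ≤ y) : ((fun i => (v i : ℝ)), y) ∈ revenueEpigraph M := by
  refine ⟨Measure.dirac v, ⟨inferInstance, fun i => ?_⟩, ?_, ?_⟩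
  · rw [integral_dirac]
  · exact integrable_dirac (by simp)
  · rwa [integral_dirac]

lemma exists_minorant_of_notMem (hvbar : 0 < vbar) {m : Fin n → ℝ}
    (hm : ∀ i, m i ∈ Set.Ioo (0 : ℝ) vbar) {M : Mechanism n vbar} (hM : M ∈ admissible n vbar)
    {a : ℝ} (ha : (m, a) ∉ revenueEpigraph M) :
    ∃ l : Fin n → ℝ,
      ∀ v : Profile n vbar, a + ∑ i, l i * ((v i : ℝ) - m i) ≤ M.totalTransfer v := by
  have hsub : Set.pi Set.univ (fun _ : Fin n => Set.Ioo (0 : ℝ) vbar) ×ˢ Set.Ioi vbar ⊆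
      revenueEpigraph M := by
    rintro ⟨w, y⟩ ⟨hw, hy⟩
    have hw' : ∀ i, w i ∈ Set.Icc 0 vbar := fun i => Set.Ioo_subset_Icc_self (hw i trivial)
    exact mem_revenueEpigraph M (fun i => ⟨w i, hw' i⟩)
      ((M.totalTransfer_le hM hvbar.le _).trans (le_of_lt hy))
  have hint : Set.pi Set.univ (fun _ : Fin n => Set.Ioo (0 : ℝ) vbar) ×ˢ Set.Ioi vbar ⊆
      interior (revenueEpigraph M) :=
    interior_maximal hsub ((isOpen_set_pi Set.finite_univ fun _ _ => isOpen_Ioo).prod isOpen_Ioi)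
  have hmi : (m, max vbar a + 1) ∈ interior (revenueEpigraph M) :=
    hint ⟨fun i _ => hm i, by
      have := le_max_left vbar a
      simp only [Set.mem_Ioi]; linarith⟩
  have hconv := convex_revenueEpigraph M
  obtain ⟨f, hf2⟩ := geometric_hahn_banach_open_point hconv.interior isOpen_interior
    (fun h => ha (interior_subset h))
  -- A convex set with nonempty interior lies in the closure of that interior, so the weak
  -- inequality extends to all of it.
  have hf1 : ∀ p ∈ revenueEpigraph M, f p ≤ f (m, a) := fun p hp => by
    apply closure_minimal (fun x hx => (hf2 x hx).le) (isClosed_Iic.preimage f.continuous)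
    rw [hconv.closure_interior_eq_closure_of_nonempty_interior ⟨_, hmi⟩]
    exact subset_closure hp
  set c : ℝ := f (0, 1) with hc
  set g : Fin n → ℝ := fun i => f (Pi.single i 1, 0) with hg
  have hf : ∀ (w : Fin n → ℝ) (y : ℝ), f (w, y) = ∑ i, g i * w i + c * y := fun w y => by
    have e : (w, y) = ∑ i, w i • ((Pi.single i 1 : Fin n → ℝ), (0 : ℝ)) + y • (0, 1) := by
      ext i
      · simp [Prod.fst_sum, Finset.sum_apply, Pi.single_apply]
      · simp [Prod.snd_sum]
    rw [e, map_add, map_sum, map_smul]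
    simp only [map_smul, smul_eq_mul]
    rw [mul_comm y]
    congr 1
    exact Finset.sum_congr rfl fun i _ => mul_comm _ _
  -- Strict separation at a point vertically above `(m, a)` makes the hyperplane non-vertical.
  have hneg : c < 0 := by
    have := hf2 _ hmi
    rw [hf, hf] at this
    have h1 := le_max_right vbar a
    by_contra hc0
    nlinarith
  refine ⟨fun i => g i / (-c), fun v => ?_⟩
  have h1 := hf1 _ (mem_revenueEpigraph M v le_rfl)
  rw [hf, hf] at h1
  have h2 : ∑ i, g i / (-c) * ((v i : ℝ) - m i) =
      (∑ i, g i * (v i : ℝ) - ∑ i, g i * m i) / (-c) := by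
    rw [← Finset.sum_sub_distrib, Finset.sum_div]
    exact Finset.sum_congr rfl fun i _ => by ring
  rw [h2, ← le_sub_iff_add_le', div_le_iff₀ (by linarith)]
  linarith

lemma guarantee_le (hvbar : 0 < vbar) {m : Fin n → ℝ}
    (hm : ∀ i, m i ∈ Set.Ioo (0 : ℝ) vbar) {M : Mechanism n vbar} (hM : M ∈ admissible n vbar)
    {V : ℝ} (hV : ∀ k : Fin n → ℝ, (∀ i, 0 ≤ k i) → dualValue vbar m k ≤ V) :
    M.guarantee m ≤ (V : EReal) := by
  refine EReal.le_of_forall_lt_iff_le.1 fun a ha => ?_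
  have hmem : (m, a) ∈ revenueEpigraph M := by
    by_contra hn
    obtain ⟨l, hl⟩ := exists_minorant_of_notMem hvbar hm hM hn
    have := (le_dualValue_of_minorant hvbar hm hM hl).trans (hV _ fun i => le_max_right _ _)
    exact absurd (EReal.coe_lt_coe_iff.1 ha) (not_lt.2 this)
  obtain ⟨F, hF, hFi, hFa⟩ := hmem
  refine (iInf₂_le F hF).trans ?_
  rw [M.revenue_eq_integral hFi]
  exact EReal.coe_le_coe_iff.2 hFa

/-! ### The corner-hitting auction -/

section Auction

variable (α β : Fin n → ℝ)

lemma rivalScore_nonneg (v : Profile n vbar) (i : Fin n) : 0 ≤ rivalScore α β v i :=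
  Finset.le_fold_max _ |>.2 (Or.inl le_rfl)

lemma score_le_rivalScore (v : Profile n vbar) {i j : Fin n} (h : j ≠ i) :
    score α β v j ≤ rivalScore α β v i :=
  Finset.le_fold_max _ |>.2 (Or.inr ⟨j, Finset.mem_erase.2 ⟨h, Finset.mem_univ j⟩, le_rfl⟩)

lemma rivalScore_le (v : Profile n vbar) (i : Fin n) {c : ℝ} (hc : 0 ≤ c)
    (h : ∀ j, j ≠ i → score α β v j ≤ c) : rivalScore α β v i ≤ c :=
  Finset.fold_max_le _ |>.2 ⟨hc, fun j hj => h j (Finset.ne_of_mem_erase hj)⟩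

lemma score_update_of_ne (v : Profile n vbar) {i j : Fin n} (h : j ≠ i)
    (w : Set.Icc (0 : ℝ) vbar) : score α β (Function.update v i w) j = score α β v j := by
  simp [score, Function.update_of_ne h]

/-- The threshold price ignores the bidder's own report; incentive compatibility rests on this. -/
lemma rivalScore_update (v : Profile n vbar) (i : Fin n) (w : Set.Icc (0 : ℝ) vbar) :
    rivalScore α β (Function.update v i w) i = rivalScore α β v i :=
  Finset.fold_congr fun _ hj => score_update_of_ne α β v (Finset.ne_of_mem_erase hj) w

lemma measurable_score (i : Fin n) : Measurable fun v : Profile n vbar => score α β v i := by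
  unfold score
  fun_prop

lemma measurable_rivalScore (i : Fin n) :
    Measurable fun v : Profile n vbar => rivalScore α β v i := by
  unfold rivalScore
  induction Finset.univ.erase i using Finset.induction_on with
  | empty => simp
  | insert j s hj ih =>
    simp only [Finset.fold_insert hj]
    exact (measurable_score α β j).max ih

/-- Profiles at which bidder `i` has the highest score, positive, ties going to lower indices. -/
def winSet (i : Fin n) : Set (Profile n vbar) :=
  {v | 0 < score α β v i ∧ ∀ j, score α β v j ≤ score α β v i ∧
    (j < i → score α β v j < score α β v i)}

lemma measurableSet_winSet (i : Fin n) : MeasurableSet (winSet α β i : Set (Profile n vbar)) := by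
  have e : (winSet α β i : Set (Profile n vbar)) = {v | 0 < score α β v i} ∩
      ⋂ j, ({v | score α β v j ≤ score α β v i} ∩
        {v | j < i → score α β v j < score α β v i}) := by
    ext v; simp [winSet]
  rw [e]
  refine (measurableSet_lt measurable_const (measurable_score α β i)).inter
    (MeasurableSet.iInter fun j =>
      (measurableSet_le (measurable_score α β j) (measurable_score α β i)).inter ?_)
  by_cases hji : j < i
  · simpa [hji] using measurableSet_lt (measurable_score α β j) (measurable_score α β i)
  · simp [hji]

lemma winSet_unique {v : Profile n vbar} {i j : Fin n} (hi : v ∈ winSet α β i)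
    (hj : v ∈ winSet α β j) : i = j := by
  rcases lt_trichotomy i j with h | h | h
  · exact absurd ((hj.2 i).2 h) (not_lt.2 (hi.2 j).1)
  · exact h
  · exact absurd ((hi.2 j).2 h) (not_lt.2 (hj.2 i).1)

/-- The auction that awards the object to the highest positive score at the threshold price. -/
noncomputable def scoreAuction : Mechanism n vbar where
  x i := (winSet α β i).indicator 1
  t i := (winSet α β i).indicator fun v => (rivalScore α β v i + α i) / β i
  measurable_x i := measurable_one.indicator (measurableSet_winSet α β i)
  measurable_t i := (((measurable_rivalScore α β i).add_const _).div_const _).indicator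
    (measurableSet_winSet α β i)
  deterministic i v := by
    by_cases h : v ∈ winSet α β i <;> simp [h]
  supply v := by
    by_cases h : ∃ i, v ∈ winSet α β i
    · obtain ⟨i, hi⟩ := h
      rw [Finset.sum_eq_single i]
      · simp [hi]
      · intro j _ hj
        exact Set.indicator_of_notMem (fun hjv => hj (winSet_unique α β hjv hi)) _
      · simp
    · push Not at h
      simp [h]

variable {α β}

lemma mem_winSet_of_rivalScore_lt {v : Profile n vbar} {i : Fin n}
    (h : rivalScore α β v i < score α β v i) : v ∈ winSet α β i := by
  refine ⟨(rivalScore_nonneg α β v i).trans_lt h, fun j => ?_⟩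
  rcases eq_or_ne j i with rfl | hj
  · simp
  · have := (score_le_rivalScore α β v hj).trans_lt h
    exact ⟨this.le, fun _ => this⟩

lemma rivalScore_le_of_mem_winSet {v : Profile n vbar} {i : Fin n} (h : v ∈ winSet α β i) :
    rivalScore α β v i ≤ score α β v i :=
  rivalScore_le α β v i h.1.le fun j _ => (h.2 j).1

lemma scoreAuction_payoff (i : Fin n) (w : Set.Icc (0 : ℝ) vbar) (v : Profile n vbar) :
    (scoreAuction α β).payoff i w v =
      (winSet α β i).indicator (fun v => (w : ℝ) - (rivalScore α β v i + α i) / β i) v := by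
  by_cases h : v ∈ winSet α β i <;> simp [Mechanism.payoff, scoreAuction, h]

lemma price_le_iff (hβ : ∀ i, 0 < β i) (v : Profile n vbar) (i : Fin n) :
    (rivalScore α β v i + α i) / β i ≤ v i ↔ rivalScore α β v i ≤ score α β v i := by
  rw [div_le_iff₀ (hβ i), score, le_sub_iff_add_le, mul_comm]

lemma scoreAuction_EPIR (hβ : ∀ i, 0 < β i) :
    (scoreAuction α β : Mechanism n vbar).IsEPIR := fun i v => by
  rw [scoreAuction_payoff]
  refine Set.indicator_apply_nonneg fun h => ?_
  exact sub_nonneg.2 ((price_le_iff hβ v i).2 (rivalScore_le_of_mem_winSet h))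

lemma scoreAuction_admissible (hβ : ∀ i, 0 < β i) :
    (scoreAuction α β : Mechanism n vbar) ∈ admissible n vbar := by
  refine ⟨fun i v w => ?_, scoreAuction_EPIR hβ⟩
  by_cases hw : Function.update v i w ∈ winSet α β i
  · by_cases hv : v ∈ winSet α β i
    · simp [scoreAuction_payoff, hw, hv, rivalScore_update]
    · rw [scoreAuction_payoff, scoreAuction_payoff, Set.indicator_of_mem hw,
        Set.indicator_of_notMem hv, rivalScore_update, sub_nonpos]
      have h : score α β v i ≤ rivalScore α β v i :=
        not_lt.1 fun h => hv (mem_winSet_of_rivalScore_lt h)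
      rw [le_div_iff₀ (hβ i)]
      rw [score] at h
      linarith
  · refine le_trans (le_of_eq ?_) (scoreAuction_EPIR hβ i v)
    rw [scoreAuction_payoff, Set.indicator_of_notMem hw]

lemma scoreAuction_isLinearScoreAuction (hα : ∀ i, 0 ≤ α i) (hβ : ∀ i, 0 < β i) :
    (scoreAuction α β : Mechanism n vbar).IsLinearScoreAuction α β := by
  refine ⟨scoreAuction_admissible hβ, fun i => ⟨hα i, hβ i⟩, fun i v => ⟨fun h => ?_, fun h => ?_⟩⟩
  · simp [scoreAuction, mem_winSet_of_rivalScore_lt h]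
  · have : v ∉ winSet α β i := fun hv => absurd h (not_lt.2 (rivalScore_le_of_mem_winSet hv))
    simp [scoreAuction, this]

lemma scoreAuction_t_of_notMem {v : Profile n vbar} {i : Fin n} (h : v ∉ winSet α β i) :
    (scoreAuction α β).t i v = 0 := by
  simp [scoreAuction, h]

lemma scoreAuction_totalTransfer_of_mem {v : Profile n vbar} {i : Fin n}
    (h : v ∈ winSet α β i) :
    (scoreAuction α β).totalTransfer v = (rivalScore α β v i + α i) / β i := by
  rw [Mechanism.totalTransfer, Finset.sum_eq_single i]
  · simp [scoreAuction, h]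
  · intro j _ hj
    exact scoreAuction_t_of_notMem fun hjv => hj (winSet_unique α β hjv h)
  · simp

lemma scoreAuction_totalTransfer_of_notMem {v : Profile n vbar}
    (h : ∀ i, v ∉ winSet α β i) : (scoreAuction α β).totalTransfer v = 0 :=
  Finset.sum_eq_zero fun i _ => scoreAuction_t_of_notMem (h i)

lemma scoreAuction_totalTransfer_nonneg (hα : ∀ i, 0 ≤ α i) (hβ : ∀ i, 0 < β i)
    (v : Profile n vbar) : 0 ≤ (scoreAuction α β).totalTransfer v :=
  Finset.sum_nonneg fun i _ => by
    by_cases h : v ∈ winSet α β i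
    · simpa [scoreAuction, h] using
        div_nonneg (add_nonneg (rivalScore_nonneg α β v i) (hα i)) (hβ i).le
    · rw [scoreAuction_t_of_notMem h]

lemma exists_mem_winSet {v : Profile n vbar} {j : Fin n} (hj : 0 < score α β v j) :
    ∃ i, v ∈ winSet α β i := by
  obtain ⟨k, -, hk⟩ := Finset.exists_max_image Finset.univ (score α β v) ⟨j, Finset.mem_univ j⟩
  classical
  -- The tie-breaking rule selects the least index among the maximizers.
  set S := Finset.univ.filter fun i => score α β v i = score α β v k with hS
  have hne : S.Nonempty := ⟨k, by simp [hS]⟩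
  have hmin := S.min'_mem hne
  set i := S.min' hne with hi
  have hik : score α β v i = score α β v k := by simpa [hS] using hmin
  refine ⟨i, ?_, fun l => ⟨?_, fun hl => ?_⟩⟩
  · rw [hik]; exact hj.trans_le (hk j (Finset.mem_univ j))
  · rw [hik]; exact hk l (Finset.mem_univ l)
  · rw [hik]
    refine lt_of_le_of_ne (hk l (Finset.mem_univ l)) fun he => ?_
    exact absurd (S.min'_le l (by simp [hS, he])) (not_le.2 hl)

end Auction

/-- The revenue of the corner-hitting auction with the reserve prices of `l` lies above an affine
function with slopes `l` that is nonpositive at the reserves and at most `vbar` at the top. -/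
lemma minorant_scoreAuction (hvbar : 0 < vbar) {m l : Fin n → ℝ} (hl : ∀ i, 0 ≤ l i)
    (v : Profile n vbar) :
    dualValue vbar m l + ∑ i, l i * ((v i : ℝ) - m i) ≤
      (scoreAuction (fun i => cornerIntercept vbar (reserve vbar (l i)))
        (fun i => cornerSlope vbar (reserve vbar (l i)))).totalTransfer v := by
  set r : Fin n → ℝ := fun i => reserve vbar (l i) with hr
  have hr0 : ∀ i, 0 ≤ r i := fun i => reserve_nonneg hvbar (hl i)
  have hrv : ∀ i, 0 < vbar - r i := fun i => sub_pos.2 (reserve_lt hvbar (hl i))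
  have hlr : ∀ i, l i * (vbar - r i) = r i := fun i => mul_sub_reserve (hl i)
  set α : Fin n → ℝ := fun i => cornerIntercept vbar (r i) with hα
  set β : Fin n → ℝ := fun i => cornerSlope vbar (r i) with hβ
  have hαi : ∀ i, α i = r i / (vbar - r i) := fun i => if_pos (sub_pos.1 (hrv i))
  have hβi : ∀ i, β i = 1 / (vbar - r i) := fun i => if_pos (sub_pos.1 (hrv i))
  set s := score α β v with hs
  have hv : ∀ i, (v i : ℝ) = r i + (vbar - r i) * s i := fun i => by
    have := (hrv i).ne'
    rw [hs, score, hαi, hβi]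
    field_simp
    ring
  -- In score coordinates every bidder has reserve 0 and top 1.
  have hs1 : ∀ i, s i ≤ 1 := fun i => by
    have h1 := hv i
    have h2 := (v i).2.2
    have h3 := hrv i
    by_contra h4
    nlinarith
  set V := dualValue vbar m l with hV
  -- The affine function equals `C` at the reserve profile and `C + ∑ i, r i` at the top corner.
  set C := V + ∑ i, l i * (r i - m i) with hC
  have hC0 : C ≤ 0 := by
    have h1 : V ≤ ∑ i, l i * (m i - r i) := min_le_left _ _
    have h2 : ∑ i, l i * (m i - r i) = -∑ i, l i * (r i - m i) := by
      rw [← Finset.sum_neg_distrib]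
      exact Finset.sum_congr rfl fun i _ => by ring
    linarith
  have hC1 : C + ∑ i, r i ≤ vbar := by
    have h1 : V ≤ vbar - ∑ i, l i * (vbar - m i) := min_le_right _ _
    have h2 : ∑ i, l i * (vbar - m i) = ∑ i, l i * (r i - m i) + ∑ i, r i := by
      rw [← Finset.sum_add_distrib]
      exact Finset.sum_congr rfl fun i _ => by linarith [hlr i]
    linarith
  have hL : V + ∑ i, l i * ((v i : ℝ) - m i) = C + ∑ i, r i * s i := by
    rw [hC, add_assoc, ← Finset.sum_add_distrib]
    congr 1
    refine Finset.sum_congr rfl fun i _ => ?_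
    rw [hv i]
    linear_combination s i * hlr i
  rw [hL]
  by_cases hw : ∃ i, v ∈ winSet α β i
  · obtain ⟨i, hi⟩ := hw
    rw [scoreAuction_totalTransfer_of_mem hi]
    set y := rivalScore α β v i with hy
    have hy0 : 0 ≤ y := rivalScore_nonneg α β v i
    have hy1 : y ≤ 1 := (rivalScore_le_of_mem_winSet hi).trans (hs1 i)
    have hp : (y + α i) / β i = r i + (vbar - r i) * y := by
      have := (hrv i).ne'
      rw [hαi, hβi]
      field_simp
      ring
    rw [hp]
    -- With `s i ≤ 1` and rival scores at most `y`, the affine function is at most `(1 - y) * (C + r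
    -- i) + y * (C + ∑ j, r j)`, hence at most `(1 - y) * r i + y * vbar`, the price.
    have h1 : ∑ j ∈ Finset.univ.erase i, r j * s j ≤ ∑ j ∈ Finset.univ.erase i, r j * y :=
      Finset.sum_le_sum fun j hj => mul_le_mul_of_nonneg_left
        (score_le_rivalScore α β v (Finset.ne_of_mem_erase hj)) (hr0 j)
    have h2 := Finset.add_sum_erase Finset.univ (fun j => r j * s j) (Finset.mem_univ i)
    have h3 := Finset.add_sum_erase Finset.univ r (Finset.mem_univ i)
    rw [← Finset.sum_mul] at h1
    have h4 := mul_le_mul_of_nonneg_left (hs1 i) (hr0 i)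
    have h5 := mul_le_mul_of_nonneg_right hC1 hy0
    have h6 := mul_nonneg (neg_nonneg.2 hC0) (sub_nonneg.2 hy1)
    rw [← h2]
    rw [← h3] at h5
    linarith
  · push Not at hw
    rw [scoreAuction_totalTransfer_of_notMem hw]
    have : ∑ i, r i * s i ≤ 0 := Finset.sum_nonpos fun i _ =>
      mul_nonpos_of_nonneg_of_nonpos (hr0 i) (not_lt.1 fun h => by
        obtain ⟨k, hk⟩ := exists_mem_winSet h
        exact hw k hk)
    linarith

lemma le_guarantee_of_minorant (hvbar : 0 ≤ vbar) {m : Fin n → ℝ} {M : Mechanism n vbar}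
    (hM : M ∈ admissible n vbar) (h0 : ∀ v, 0 ≤ M.totalTransfer v) {a : ℝ} {l : Fin n → ℝ}
    (h : ∀ v : Profile n vbar, a + ∑ i, l i * ((v i : ℝ) - m i) ≤ M.totalTransfer v) :
    (a : EReal) ≤ M.guarantee m := by
  refine le_iInf₂ fun F hF => ?_
  have := hF.1
  have hi : Integrable M.totalTransfer F := by
    refine Integrable.of_bound M.measurable_totalTransfer.aestronglyMeasurable vbar
      (Filter.Eventually.of_forall fun v => ?_)
    rw [Real.norm_eq_abs, abs_of_nonneg (h0 v)]
    exact M.totalTransfer_le hM hvbar v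
  obtain ⟨hli, hle⟩ := integral_affine hF a l
  rw [M.revenue_eq_integral hi, EReal.coe_le_coe_iff, ← hle]
  exact integral_mono hli hi h

end RobustAuction

theorem mainTheorem2 (n : ℕ) (hn : 2 ≤ n) (vbar : ℝ) (hvbar : 0 < vbar)
    (m : Fin n → ℝ) (hm : ∀ i, m i ∈ Set.Ioo (0 : ℝ) vbar) :
    ∃ M : RobustAuction.Mechanism n vbar, M.IsCornerHitting ∧ M.SolvesMaxmin m := by
  open RobustAuction in
  obtain ⟨l, hl, hmax⟩ := exists_dualValue_max hvbar hm
  -- Finite slopes keep the reserves below `vbar`, so the degenerate branch of the score never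
  -- occurs.
  have hr : ∀ i, reserve vbar (l i) < vbar := fun i => reserve_lt hvbar (hl i)
  have hr0 : ∀ i, 0 ≤ reserve vbar (l i) := fun i => reserve_nonneg hvbar (hl i)
  have hα : ∀ i, 0 ≤ cornerIntercept vbar (reserve vbar (l i)) := fun i => by
    rw [cornerIntercept, if_pos (hr i)]
    exact div_nonneg (hr0 i) (sub_nonneg.2 (hr i).le)
  have hβ : ∀ i, 0 < cornerSlope vbar (reserve vbar (l i)) := fun i => by
    rw [cornerSlope, if_pos (hr i)]
    exact one_div_pos.2 (sub_pos.2 (hr i))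
  have hadm := scoreAuction_admissible (vbar := vbar)
    (α := fun i => cornerIntercept vbar (reserve vbar (l i))) hβ
  refine ⟨scoreAuction (fun i => cornerIntercept vbar (reserve vbar (l i)))
    (fun i => cornerSlope vbar (reserve vbar (l i))),
    ⟨fun i => reserve vbar (l i), fun i => ⟨hr0 i, (hr i).le⟩,
      scoreAuction_isLinearScoreAuction hα hβ⟩, hadm, le_antisymm ?_ ?_⟩
  · exact le_iSup₂ (f := fun (M : Mechanism n vbar) (_ : M ∈ admissible n vbar) =>
      M.guarantee m) _ hadm
  · refine iSup₂_le fun M hM => (guarantee_le hvbar hm hM hmax).trans ?_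
    exact le_guarantee_of_minorant hvbar.le hadm (scoreAuction_totalTransfer_nonneg hα hβ)
      (minorant_scoreAuction hvbar hl)
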